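/- A vocabulary $\mathcal S$ consists of a nonempty set of module names $M$, each with an arity $\mathrm{ar}(M)\in\mathbb N$ and an input arity $\mathrm{iar}(M)\le \mathrm{ar}(M)$. Fix a vocabulary $\mathcal S$ with countably many names, a nonempty countable (finite or infinite) set $\mathbb V$ of variables, and a countably infinite set $\mathbf{dom}$ of data elements; names and variables are numbered injectively by natural numbers. An interpretation $D$ assigns to each name $M$ a relation $D(M)\subseteq \mathbf{dom}^{\mathrm{ar}(M)}$. A valuation is a function $\mathbb V\to\mathbf{dom}$. The LIF expressions over $\mathcal S$ are given by $$\alpha ::= \mathit{id}\mid M(\bar z)\mid \alpha\cup\alpha\mid\alpha\cap\alpha\mid\alpha\setminus\alpha\mid\alpha\,;\alpha\mid \mathrm{cyl}^{l}_{Z}(\alpha)\mid \mathrm{cyl}^{r}_{Z}(\alpha)\mid\sigma^{lr}_{x=y}(\alpha)\mid\sigma^{l}_{x=y}(\alpha)\mid\sigma^{r}_{x=y}(\alpha),$$ where $M$ is a name, $\bar z$ is a tuple of $\mathrm{ar}(M)$ variables, $Z$ is a finite set of variables, and $x,y$ are variables. In an interpretation $D$ an expression $\alpha$ denotes a binary relation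 $[\![\alpha]\!]_D$ on valuations: - $\mathit{id}$ denotes the identity; $\cup,\cap,\setminus$ denote the set operations; $;$ denotes relational composition. - Write $\bar z=\bar x\cdot\bar y$ with $\bar x$ of length $\mathrm{iar}(M)$. Then $(\nu_1,\nu_2)\in[\![M(\bar z)]\!]_D$ iff $\nu_1(\bar x)\cdot\nu_2(\bar y)\in D(M)$ and $\nu_1,\nu_2$ agree on all variables not in $\bar y$. - $(\nu_1,\nu_2)\in[\![\mathrm{cyl}^{l}_{Z}(\alpha)]\!]_D$ iff $(\nu_1',\nu_2)\in[\![\alpha]\!]_D$ for some $\nu_1'$ that agrees with $\nu_1$ outside $Z$; symmetrically, for $\mathrm{cyl}^{r}_{Z}$, the right valuation may be changed on $Z$. - $\sigma^{l}_{x=y}$, $\sigma^{r}_{x=y}$, $\sigma^{lr}_{x=y}$ keep those pairs $(\nu_1,\nu_2)$ with $\nu_1(x)=\nu_1(y)$, $\nu_2(x)=\nu_2(y)$, $\nu_1(x)=\nu_2(y)$, respectively. A variable $x$ is a semantic output of $\alpha$ if there are an interpretation $D$ and a pair $(\nu_1,\nu_2)\in[\![\alpha]\!]_D$ with $\nu_1(x)\ne\nu_2(x)$.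 **Proposition.** Suppose that $\mathcal S$ has a module name $M$ with $\mathrm{ar}(M)\ge 2$ such that $|\mathbb V|\ge 2$ or $0<\mathrm{iar}(M)<\mathrm{ar}(M)$. Then the following problem is undecidable: given a variable $x\in\mathbb V$ and a LIF expression $\alpha$ over $\mathcal S$ (written as a word in prefix notation), is $x$ a semantic output of $\alpha$? That is, no computable predicate answers this question correctly on all instances $(x,\alpha)$. -/

import Mathlib

/-- A module vocabulary: a nonempty set of module names, each with an arity and an input arity. -/
structure Vocabulary where
  Names : Type*
  names_nonempty : Nonempty Names
  ar : Names → ℕ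
  iar : Names → ℕ
  iar_le_ar : ∀ M, iar M ≤ ar M

/-- An interpretation assigns to each module name `M` an `ar M`-ary relation over `dom`. -/
abbrev Interpretation (S : Vocabulary) (dom : Type*) : Type _ :=
  (M : S.Names) → Set (Fin (S.ar M) → dom)

/-- A valuation is a function from variables to data elements. -/
abbrev VarValuation (V dom : Type*) : Type _ := V → dom

/-- A binary relation on valuations. -/
abbrev BRV (V dom : Type*) : Type _ := Set (VarValuation V dom × VarValuation V dom)

namespace BRV

variable {V dom : Type*}

/-- The identity relation on valuations. -/
def ident : BRV V dom := {p | p.1 = p.2}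

/-- Composition `A ; B`. -/
def comp (A B : BRV V dom) : BRV V dom := {p | ∃ ν, (p.1, ν) ∈ A ∧ (ν, p.2) ∈ B}

/-- Left cylindrification. -/
def cylL (Z : Finset V) (A : BRV V dom) : BRV V dom :=
  {p | ∃ ν, (ν, p.2) ∈ A ∧ ∀ v, v ∉ Z → ν v = p.1 v}

/-- Right cylindrification. -/
def cylR (Z : Finset V) (A : BRV V dom) : BRV V dom :=
  {p | ∃ ν, (p.1, ν) ∈ A ∧ ∀ v, v ∉ Z → ν v = p.2 v}

/-- Left selection `x = y`. -/
def selL (x y : V) (A : BRV V dom) : BRV V dom := {p | p ∈ A ∧ p.1 x = p.1 y}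

/-- Right selection `x = y`. -/
def selR (x y : V) (A : BRV V dom) : BRV V dom := {p | p ∈ A ∧ p.2 x = p.2 y}

/-- Left-to-right selection `x = y`. -/
def selLR (x y : V) (A : BRV V dom) : BRV V dom := {p | p ∈ A ∧ p.1 x = p.2 y}

end BRV

/-- LIF expressions over the vocabulary `S` with variables from `V`. -/
inductive LIF (S : Vocabulary) (V : Type*) where
  | id : LIF S V
  | atom (M : S.Names) (z : Fin (S.ar M) → V) : LIF S V
  | union (α β : LIF S V) : LIF S V
  | inter (α β : LIF S V) : LIF S V
  | diff (α β : LIF S V) : LIF S V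
  | comp (α β : LIF S V) : LIF S V
  | cylL (Z : Finset V) (α : LIF S V) : LIF S V
  | cylR (Z : Finset V) (α : LIF S V) : LIF S V
  | selLR (x y : V) (α : LIF S V) : LIF S V
  | selL (x y : V) (α : LIF S V) : LIF S V
  | selR (x y : V) (α : LIF S V) : LIF S V

namespace LIF

variable {S : Vocabulary} {V dom : Type*}

/-- The semantics of an atomic module expression `M(z)`: the first `iar M` positions of `z` are
the inputs, read in the left valuation; the others are the outputs, read in the right valuation;
all variables that are not at an output position are preserved. -/
def atomSem (D : Interpretation S dom) (M : S.Names) (z : Fin (S.ar M) → V) : BRV V dom :=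
  {p | (fun i : Fin (S.ar M) => if (i : ℕ) < S.iar M then p.1 (z i) else p.2 (z i)) ∈ D M ∧
    ∀ v, (∀ i : Fin (S.ar M), S.iar M ≤ (i : ℕ) → z i ≠ v) → p.1 v = p.2 v}

/-- The semantics of LIF expressions; for fixed `α`, the map `fun D => sem D α` is the global BRV
denoted by `α`. -/
def sem (D : Interpretation S dom) : LIF S V → BRV V dom
  | id => BRV.ident
  | atom M z => atomSem D M z
  | union α β => sem D α ∪ sem D β
  | inter α β => sem D α ∩ sem D β
  | diff α β => sem D α \ sem D β
  | comp α β => BRV.comp (sem D α) (sem D β)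
  | cylL Z α => BRV.cylL Z (sem D α)
  | cylR Z α => BRV.cylR Z (sem D α)
  | selLR x y α => BRV.selLR x y (sem D α)
  | selL x y α => BRV.selL x y (sem D α)
  | selR x y α => BRV.selR x y (sem D α)

end LIF

/-- `x` is a semantic output of the global BRV `Q`. -/
def IsSemanticOutput {S : Vocabulary} {V dom : Type*} (Q : Interpretation S dom → BRV V dom)
    (x : V) : Prop :=
  ∃ D : Interpretation S dom, ∃ p ∈ Q D, p.1 x ≠ p.2 x

/-- The set of semantic outputs of a LIF expression, where `dom` is the universe of data
elements. -/
def LIF.semanticOutputs {S : Vocabulary} {V : Type*} (dom : Type*) (α : LIF S V) : Set V :=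
  {x | IsSemanticOutput (fun D : Interpretation S dom => α.sem D) x}

namespace LIF

variable {S : Vocabulary} {V : Type*} [Encodable S.Names] [Encodable V]

/-- A finite set of variables as a word: its size, followed by its members in increasing order of
their numbers. -/
def codeFinset (Z : Finset V) : List ℕ :=
  Z.card :: (Z.map (Encodable.encode' V)).sort

/-- LIF expressions as words over `ℕ`, in prefix (Polish) notation; variables and module names
are written as their numbers. -/
def code : LIF S V → List ℕ
  | id => [0]
  | atom M z => 1 :: Encodable.encode M :: List.ofFn (fun i => Encodable.encode (z i))
  | union α β => 2 :: (code α ++ code β)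
  | inter α β => 3 :: (code α ++ code β)
  | diff α β => 4 :: (code α ++ code β)
  | comp α β => 5 :: (code α ++ code β)
  | cylL Z α => 6 :: (codeFinset Z ++ code α)
  | cylR Z α => 7 :: (codeFinset Z ++ code α)
  | selLR x y α => 8 :: Encodable.encode x :: Encodable.encode y :: code α
  | selL x y α => 9 :: Encodable.encode x :: Encodable.encode y :: code α
  | selR x y α => 10 :: Encodable.encode x :: Encodable.encode y :: code α

theorem codeFinset_append_inj {Z Z' : Finset V} {s t : List ℕ}
    (h : codeFinset Z ++ s = codeFinset Z' ++ t) : Z = Z' ∧ s = t := by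
  simp only [codeFinset, List.cons_append, List.cons.injEq] at h
  obtain ⟨h1, h2⟩ := h
  obtain ⟨h3, h4⟩ := List.append_inj h2 (by simp [h1])
  refine ⟨?_, h4⟩
  have := congrArg List.toFinset h3
  simpa using this

theorem code_append_inj (α β : LIF S V) (s t : List ℕ) (h : code α ++ s = code β ++ t) :
    α = β ∧ s = t := by
  induction α generalizing β s t with
  | id => cases β <;> simp_all [code]
  | atom M z =>
    cases β <;> simp only [code, List.cons_append, List.cons.injEq] at h <;> try omega
    rename_i M' z'
    obtain ⟨-, h1, h2⟩ := h
    obtain rfl := Encodable.encode_injective h1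
    obtain ⟨h3, h4⟩ := List.append_inj h2 (by simp)
    refine ⟨?_, h4⟩
    have h5 := List.ofFn_injective h3
    congr 1
    funext i
    exact Encodable.encode_injective (congrFun h5 i)
  | union a b iha ihb | inter a b iha ihb | diff a b iha ihb | comp a b iha ihb =>
    cases β <;> simp only [code, List.cons_append, List.cons.injEq, List.append_assoc] at h <;>
      try omega
    obtain ⟨h1, h2⟩ := iha _ _ _ h.2
    obtain ⟨h3, h4⟩ := ihb _ _ _ h2
    exact ⟨by rw [h1, h3], h4⟩
  | cylL Z a ih | cylR Z a ih =>
    cases β <;> simp only [code, List.cons_append, List.cons.injEq, List.append_assoc] at h <;>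
      try omega
    obtain ⟨h1, h2⟩ := codeFinset_append_inj h.2
    obtain ⟨h3, h4⟩ := ih _ _ _ h2
    exact ⟨by rw [h1, h3], h4⟩
  | selLR x y a ih | selL x y a ih | selR x y a ih =>
    cases β <;> simp only [code, List.cons_append, List.cons.injEq] at h <;> try omega
    obtain ⟨-, h1, h2, h3⟩ := h
    obtain ⟨h4, h5⟩ := ih _ _ _ h3
    exact ⟨by rw [Encodable.encode_injective h1, Encodable.encode_injective h2, h4], h5⟩

/-- Different expressions have different words. -/
theorem code_injective : Function.Injective (code : LIF S V → List ℕ) := fun α β h =>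
  (code_append_inj α β [] [] (by rw [h])).1

end LIF

/-- The semantic output membership problem (given a variable `x` and a LIF expression `α` over
`S`, is `x` a semantic output of `α`?) is decidable: some computable predicate answers it
correctly on every instance `(x, α)`, presented as the number of `x` and the word of `α`. Nothing
is asked on inputs that do not present an instance. -/
def SemanticOutputMembershipDecidable (S : Vocabulary) (V dom : Type*)
    [Encodable S.Names] [Encodable V] : Prop :=
  ∃ P : ℕ × List ℕ → Prop, ComputablePred P ∧
    ∀ (x : V) (α : LIF S V), P (Encodable.encode x, α.code) ↔ x ∈ α.semanticOutputs dom

/-! The complement of a halting problem reduces to satisfiability of terms in the converse-free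
algebra of binary relations, and that reduces to semantic outputs.

Letters stand for the basic list operations and for the loops `Code.fix`, and laws for them are
stated by the emptiness of terms. A structure obeying the laws may contain spurious pairs, but it
receives a letter-preserving map from the lists (`ListLetter.exists_represents`). Graphs of codes
are positive terms, so every true computation survives in it (`ListLetter.Represents.sem_graph`). A
loop letter need only be closed under backward steps, because a halting run is finite. Hence
`noResult`, which demands the laws and the absence of a result, is satisfiable exactly when the code
diverges; in that case the lists themselves are a model.

Path lengths then code all letters into one relation (`RelTerm.sem_encodeLetters`), realized over
`dom` by `PathGraph`. With one variable, valuations are elements and LIF operations are the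
relational ones (`LIF.mem_sem_ofRelTerm`). With two, a term becomes a test on the values of `x` and
`y`, and the right valuation holds the intermediate point of a composition
(`LIF.mem_sem_testOfRelTerm`). Cylindrifying on both sides turns nonemptiness into `x` being an
output.

The input `n` enters only as `n` nested compositions, so its word is computable; names and variables
occur only in constant words. -/

/-- Terms of the algebra of binary relations without converse, over the relation letters `Λ`. -/
inductive RelTerm (Λ : Type*) where
  | gen (i : Λ) : RelTerm Λ
  | ident : RelTerm Λ
  | top : RelTerm Λ
  | union (s t : RelTerm Λ) : RelTerm Λ
  | inter (s t : RelTerm Λ) : RelTerm Λ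
  | diff (s t : RelTerm Λ) : RelTerm Λ
  | comp (s t : RelTerm Λ) : RelTerm Λ

namespace RelTerm

variable {Λ X : Type*}

/-- The binary relation denoted by a term, given the relations denoted by the letters. -/
@[simp]
def sem (L : Λ → X → X → Prop) : RelTerm Λ → X → X → Prop
  | gen i, a, b => L i a b
  | ident, a, b => a = b
  | top, _, _ => True
  | union s t, a, b => sem L s a b ∨ sem L t a b
  | inter s t, a, b => sem L s a b ∧ sem L t a b
  | diff s t, a, b => sem L s a b ∧ ¬ sem L t a b
  | comp s t, a, b => ∃ c, sem L s a c ∧ sem L t c b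

/-- The empty relation. -/
def bot : RelTerm Λ := diff ident ident

@[simp]
theorem sem_bot (L : Λ → X → X → Prop) (a b : X) : ¬ (bot : RelTerm Λ).sem L a b := by
  simp [bot]

end RelTerm

/-! ### Partial recursive functions as relation terms. -/

open Turing.ToPartrec (Code)

/-- Relation letters describing the basic operations on lists of natural numbers, and the results
of the loops `Code.fix c`. -/
inductive ListLetter where
  | nil | push | incr | cons | tail | zeroTail | decr | sameHead
  | loop (c : Code) : ListLetter

namespace ListLetter

/-- The intended meaning of the letters, on lists of natural numbers. -/
@[simp]
def interp : ListLetter → List ℕ → List ℕ → Prop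
  | nil, v, w => v = [] ∧ w = []
  | push, v, w => w = 0 :: v
  | incr, v, w => ∃ n u, v = n :: u ∧ w = (n + 1) :: u
  | cons, v, w => ∃ n, w = n :: v
  | tail, v, w => w = v.tail
  | zeroTail, v, w => v.headI = 0 ∧ w = v.tail
  | decr, v, w => ∃ n u, v = (n + 1) :: u ∧ w = n :: u
  | sameHead, v, w => v.headI = w.headI
  | loop c, v, w => w ∈ (Code.fix c).eval v

end ListLetter

namespace Turing.ToPartrec.Code

open ListLetter RelTerm

/-- A numbering of the codes. -/
def number : Code → ℕ
  | zero' => 0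
  | succ => 1
  | tail => 2
  | cons f g => 4 * Nat.pair f.number g.number + 3
  | comp f g => 4 * Nat.pair f.number g.number + 4
  | case f g => 4 * Nat.pair f.number g.number + 5
  | fix f => 4 * f.number + 6

theorem number_injective : Function.Injective number := by
  intro c
  induction c with
  | zero' | succ | tail => intro d h; cases d <;> simp [number] at h ⊢
  | cons f g hf hg | comp f g hf hg | case f g hf hg =>
    intro d h
    cases d <;> simp only [number] at h <;> try omega
    rename_i f' g'
    have h1 : Nat.pair f.number g.number = Nat.pair f'.number g'.number := by omega
    rw [Nat.pair_eq_pair] at h1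
    rw [hf h1.1, hg h1.2]
  | fix f hf =>
    intro d h
    cases d <;> simp only [number] at h <;> try omega
    rename_i f'
    rw [hf (show f.number = f'.number by omega)]

/-- The graph of a code as a term over the list letters. -/
def graph : Code → RelTerm ListLetter
  | zero' => gen push
  -- `Code.succ` discards the tail, so the path first moves to the singleton list with the same
  -- head.
  | succ => .comp (inter (gen sameHead) (.comp top (.comp (gen .nil) (gen .cons)))) (gen incr)
  | tail => gen .tail
  | cons f g => inter (.comp f.graph (gen sameHead)) (.comp g.graph (gen .cons))
  | comp f g => .comp g.graph f.graph
  | case f g => union (.comp (gen zeroTail) f.graph) (.comp (gen decr) g.graph)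
  | fix f => gen (loop f)

/-- The pairs at which some loop letter in `c.graph` fails to be closed under the steps of its
loop. -/
def loopDefect : Code → RelTerm ListLetter
  | zero' | succ | tail => bot
  | cons f g | comp f g | case f g => union f.loopDefect g.loopDefect
  | fix f => union f.loopDefect (union
      (diff (.comp f.graph (gen zeroTail)) (gen (loop f)))
      (diff (.comp f.graph (.comp (gen decr) (.comp (gen .tail) (gen (loop f))))) (gen (loop f))))

theorem mem_fix_eval_iff {f : Code} {v w : List ℕ} : w ∈ (fix f).eval v ↔
    ∃ u ∈ f.eval v, (u.headI = 0 ∧ w = u.tail) ∨ (u.headI ≠ 0 ∧ w ∈ (fix f).eval u.tail) := by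
  have key := PFun.mem_fix_iff (f := fun v => (f.eval v).map fun v : List ℕ =>
      if v.headI = 0 then Sum.inl v.tail else Sum.inr v.tail) (a := v) (b := w)
  rw [← fix_eval] at key
  refine key.trans ?_
  simp only [Part.mem_map_iff]
  constructor
  · rintro (⟨u, hu, h⟩ | ⟨a, ⟨u, hu, h⟩, ha⟩)
    · refine ⟨u, hu, ?_⟩
      split_ifs at h with h0
      simp_all
    · refine ⟨u, hu, ?_⟩
      split_ifs at h with h0
      simp_all
  · rintro ⟨u, hu, ⟨h0, rfl⟩ | ⟨h0, h⟩⟩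
    · exact Or.inl ⟨u, hu, by simp [h0]⟩
    · exact Or.inr ⟨_, ⟨u, hu, by simp [h0]⟩, h⟩

/-- A loop denotes a least fixed point; this is what makes closure under backward steps a sufficient
law for loop letters. -/
theorem fix_eval_induction {f : Code} {w : List ℕ} {C : List ℕ → Prop}
    (hbase : ∀ v u, u ∈ f.eval v → u.headI = 0 → w = u.tail → C v)
    (hstep : ∀ v u, u ∈ f.eval v → u.headI ≠ 0 → C u.tail → C v)
    {v : List ℕ} (h : w ∈ (fix f).eval v) : C v := by
  rw [fix_eval] at h
  refine PFun.fixInduction' (C := C) h (fun a ha => ?_) (fun a b _ hb hC => ?_)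
  · obtain ⟨u, hu, h⟩ := (Part.mem_map_iff _).1 ha
    split_ifs at h with h0
    exact hbase a u hu h0 (by simpa using h.symm)
  · obtain ⟨u, hu, h⟩ := (Part.mem_map_iff _).1 hb
    split_ifs at h with h0
    obtain rfl : u.tail = b := by simpa using h
    exact hstep a u hu h0 hC

theorem mem_case_eval_iff {f g : Code} {v w : List ℕ} : w ∈ (case f g).eval v ↔
    (v.headI = 0 ∧ w ∈ f.eval v.tail) ∨ ∃ n u, v = (n + 1) :: u ∧ w ∈ g.eval (n :: u) := by
  rcases v with _ | ⟨_ | n, v⟩ <;> simp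

theorem mem_cons_eval_iff {f g : Code} {v w : List ℕ} : w ∈ (cons f g).eval v ↔
    ∃ a ∈ f.eval v, ∃ u ∈ g.eval v, w = a.headI :: u := by
  simp [Part.bind_eq_bind]

theorem mem_comp_eval_iff {f g : Code} {v w : List ℕ} : w ∈ (comp f g).eval v ↔
    ∃ u ∈ g.eval v, w ∈ f.eval u := by
  rw [comp_eval]
  exact Part.mem_bind_iff

theorem sem_graph_interp (c : Code) (v w : List ℕ) :
    c.graph.sem interp v w ↔ w ∈ c.eval v := by
  induction c generalizing v w with
  | zero' => simp [graph]
  | succ =>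
    simp only [graph, sem, interp, succ_eval, Part.pure_eq_some, Part.mem_some_iff]
    constructor
    · rintro ⟨_, ⟨h, _, -, _, ⟨rfl, rfl⟩, n, rfl⟩, m, u, h1, rfl⟩
      simp_all
    · rintro rfl
      exact ⟨[v.headI], ⟨rfl, [], trivial, [], ⟨rfl, rfl⟩, _, rfl⟩, _, _, rfl, rfl⟩
  | tail => simp [graph]
  | cons f g hf hg =>
    rw [mem_cons_eval_iff]
    simp only [graph, sem, interp, hf, hg]
    constructor
    · rintro ⟨⟨a, ha, h⟩, u, hu, n, rfl⟩
      exact ⟨a, ha, u, hu, by simp [h]⟩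
    · rintro ⟨a, ha, u, hu, rfl⟩
      exact ⟨⟨a, ha, rfl⟩, u, hu, _, rfl⟩
  | comp f g hf hg => simp only [mem_comp_eval_iff, graph, sem, hf, hg]
  | case f g hf hg =>
    rw [mem_case_eval_iff]
    simp only [graph, sem, interp, hf, hg]
    constructor
    · rintro (⟨_, ⟨h, rfl⟩, hw⟩ | ⟨_, ⟨n, u, rfl, rfl⟩, hw⟩)
      · exact Or.inl ⟨h, hw⟩
      · exact Or.inr ⟨n, u, rfl, hw⟩
    · rintro (⟨h, hw⟩ | ⟨n, u, rfl, hw⟩)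
      · exact Or.inl ⟨_, ⟨h, rfl⟩, hw⟩
      · exact Or.inr ⟨_, ⟨n, u, rfl, rfl⟩, hw⟩
  | fix f => rfl

theorem not_sem_loopDefect_interp (c : Code) (v w : List ℕ) :
    ¬ c.loopDefect.sem interp v w := by
  induction c generalizing v w with
  | zero' | succ | tail => simp [loopDefect]
  | cons f g hf hg | comp f g hf hg | case f g hf hg => simp [loopDefect, hf, hg]
  | fix f hf =>
    simp only [loopDefect, sem, hf, false_or, sem_graph_interp, interp]
    rintro (⟨⟨u, hu, h0, rfl⟩, h⟩ | ⟨⟨_, hu, _, ⟨n, u, rfl, rfl⟩, _, rfl, h1⟩, h⟩)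
    · exact h (mem_fix_eval_iff.2 ⟨u, hu, Or.inl ⟨h0, rfl⟩⟩)
    · exact h (mem_fix_eval_iff.2 ⟨_, hu, Or.inr ⟨Nat.succ_ne_zero n, h1⟩⟩)

end Turing.ToPartrec.Code

/-! ### Laws for the letters and the divergence term. -/

namespace ListLetter

open RelTerm

/-- The pairs at which one of the laws for the basic list letters fails. -/
def defect : RelTerm ListLetter :=
  union (diff top (comp (gen push) top)) <|
  union (comp (gen cons) (diff top (comp (gen incr) top))) <|
  union (diff (gen push) (gen cons)) <|
  union (diff (comp (gen cons) (gen incr)) (gen cons)) <|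
  -- Converse is not available: emptiness of `(r ; sᶜ) ∩ id` says that `s` contains the converse of
  -- `r`. The same device serves for `push` and `incr` below.
  union (inter (comp (gen cons) (diff top (gen tail))) ident) <|
  union (diff (gen nil) (gen tail)) <|
  union (inter (comp (gen push) (diff top (gen zeroTail))) ident) <|
  union (diff (gen nil) (gen zeroTail)) <|
  union (inter (comp (gen incr) (diff top (gen decr))) ident) <|
  -- Equality of heads is generated inductively. The empty list counts as having head 0, by the
  -- default value of `headI`.
  union (diff (comp (gen zeroTail) (comp top (union (gen push) (gen nil)))) (gen sameHead)) <|
  diff (comp (gen decr) (comp (gen sameHead) (gen incr))) (gen sameHead)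

theorem not_sem_defect_interp (v w : List ℕ) : ¬ defect.sem interp v w := by
  simp only [defect, sem, interp, not_or]
  refine ⟨?_, ?_, ?_, ?_, ?_, ?_, ?_, ?_, ?_, ?_, ?_⟩
  · simp
  · rintro ⟨_, ⟨n, rfl⟩, -, h⟩
    exact h ⟨_, ⟨_, _, rfl, rfl⟩, trivial⟩
  · rintro ⟨rfl, h⟩
    exact h ⟨_, rfl⟩
  · rintro ⟨⟨_, ⟨n, rfl⟩, _, _, h, rfl⟩, h'⟩
    simp_all
  · rintro ⟨⟨_, ⟨n, rfl⟩, -, h⟩, rfl⟩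
    simp at h
  · rintro ⟨⟨rfl, rfl⟩, h⟩
    simp at h
  · rintro ⟨⟨_, rfl, -, h⟩, rfl⟩
    simp at h
  · rintro ⟨⟨rfl, rfl⟩, h⟩
    simp at h
  · rintro ⟨⟨_, ⟨n, u, rfl, rfl⟩, -, h⟩, rfl⟩
    exact h ⟨_, _, rfl, rfl⟩
  · rintro ⟨⟨_, ⟨h, rfl⟩, _, -, rfl | ⟨rfl, rfl⟩⟩, h'⟩ <;> simp_all
  · rintro ⟨⟨_, ⟨n, u, rfl, rfl⟩, _, h, _, _, rfl, rfl⟩, h'⟩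
    simp_all

/-- A map from lists into a structure for the list letters that preserves the basic letters. -/
structure Represents {X : Type*} (L : ListLetter → X → X → Prop) (e : List ℕ → X) : Prop where
  nil : L nil (e []) (e [])
  push (v) : L push (e v) (e (0 :: v))
  incr (n v) : L incr (e (n :: v)) (e ((n + 1) :: v))
  cons (n v) : L cons (e v) (e (n :: v))
  tail (v) : L tail (e v) (e v.tail)
  zeroTail (v) : v.headI = 0 → L zeroTail (e v) (e v.tail)
  decr (n v) : L decr (e ((n + 1) :: v)) (e (n :: v))
  sameHead (v w) : v.headI = w.headI → L sameHead (e v) (e w)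

variable {X : Type*} {L : ListLetter → X → X → Prop}

/-- The laws give every element a `push` successor and every `cons` target an `incr` successor.
Choosing such successors defines the map by recursion, and the remaining laws supply the other
letters. -/
theorem exists_represents (h : ∀ a b, ¬ defect.sem L a b) {x₀ : X} (h₀ : L nil x₀ x₀) :
    ∃ e, Represents L e := by
  simp only [defect, sem, not_or, not_and, not_not, true_and, forall_exists_index, not_exists,
    and_true, forall_and, and_imp, not_forall] at h
  obtain ⟨h1, h2, h3, h4, h5, h6, h7, h8, h9, h10, h11⟩ := h
  have h2' : ∀ y, ∃ z, (∃ x, L cons x y) → L incr y z := by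
    intro y
    -- Off the `cons` targets the successor function takes the junk value `y`.
    by_cases hy : ∃ x, L cons x y
    · obtain ⟨x, hx⟩ := hy
      obtain ⟨z, hz⟩ := h2 x x y hx
      exact ⟨z, fun _ => hz⟩
    · exact ⟨y, fun h => absurd h hy⟩
  choose o ho using fun x => h1 x x
  choose i hi using h2'
  let e : List ℕ → X := fun v => v.rec x₀ fun n _ y => i^[n] (o y)
  have e0 (v) : e (0 :: v) = o (e v) := rfl
  have e1 (n v) : e ((n + 1) :: v) = i (e (n :: v)) := Function.iterate_succ_apply' _ _ _
  have push (v) : L .push (e v) (e (0 :: v)) := ho _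
  have cons (n v) : L .cons (e v) (e (n :: v)) := by
    induction n with
    | zero => exact h3 _ _ (push v)
    | succ n ih => rw [e1]; exact h4 _ _ _ ih (hi _ ⟨_, ih⟩)
  have incr (n v) : L .incr (e (n :: v)) (e ((n + 1) :: v)) := by
    rw [e1]; exact hi _ ⟨_, cons n v⟩
  have decr (n v) : L .decr (e ((n + 1) :: v)) (e (n :: v)) := by
    by_contra hc
    exact h9 _ _ _ (incr n v) hc rfl
  have zeroTail (v : List ℕ) (hv : v.headI = 0) : L .zeroTail (e v) (e v.tail) := by
    rcases v with _ | ⟨n, v⟩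
    · exact h8 _ _ h₀
    · obtain rfl : n = 0 := hv
      by_contra hc
      exact h7 _ _ _ (push v) hc rfl
  -- Induction on the common head: decrement on the left, compare, increment on the right.
  have sameHead (n : ℕ) : ∀ v w : List ℕ, v.headI = n → w.headI = n →
      L .sameHead (e v) (e w) := by
    induction n with
    | zero =>
      intro v w hv hw
      have := zeroTail v hv
      rcases w with _ | ⟨m, w⟩
      · exact h10 _ _ _ this x₀ (Or.inr h₀)
      · obtain rfl : m = 0 := hw
        exact h10 _ _ _ this _ (Or.inl (push w))
    | succ n ih =>
      intro v w hv hw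
      rcases v with _ | ⟨m, v⟩
      · simp at hv
      rcases w with _ | ⟨m', w⟩
      · simp at hw
      obtain rfl : m = n + 1 := hv
      obtain rfl : m' = n + 1 := hw
      exact h11 _ _ _ (decr n v) _ (ih (n :: v) (n :: w) rfl rfl) (incr n w)
  refine ⟨e, h₀, push, incr, cons, fun v => ?_, zeroTail, decr,
    fun v w h => sameHead _ v w h rfl⟩
  rcases v with _ | ⟨n, v⟩
  · exact h6 _ _ h₀
  · by_contra hc
    exact h5 _ _ _ (cons n v) hc rfl

-- Graphs contain no difference, so preserving letters suffices. Only `fix` needs the loop laws,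
-- through induction on the run.
open Turing.ToPartrec.Code in
theorem Represents.sem_graph {e : List ℕ → X} (he : Represents L e) {c : Code}
    (hc : ∀ a b, ¬ c.loopDefect.sem L a b) {v w : List ℕ} (h : w ∈ c.eval v) :
    c.graph.sem L (e v) (e w) := by
  induction c generalizing v w with
  | zero' =>
    obtain rfl : w = 0 :: v := by simpa using h
    exact he.push v
  | succ =>
    obtain rfl : w = [v.headI + 1] := by simpa using h
    exact ⟨e [v.headI], ⟨he.sameHead _ _ rfl, e [], trivial, e [], he.nil, he.cons _ _⟩,
      he.incr _ _⟩
  | tail =>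
    obtain rfl : w = v.tail := by simpa using h
    exact he.tail v
  | cons f g hf hg =>
    simp only [loopDefect, sem, not_or, forall_and] at hc
    obtain ⟨a, ha, u, hu, rfl⟩ := mem_cons_eval_iff.1 h
    exact ⟨⟨_, hf hc.1 ha, he.sameHead _ _ rfl⟩, _, hg hc.2 hu, he.cons _ _⟩
  | comp f g hf hg =>
    simp only [loopDefect, sem, not_or, forall_and] at hc
    obtain ⟨u, hu, hw⟩ := mem_comp_eval_iff.1 h
    exact ⟨_, hg hc.2 hu, hf hc.1 hw⟩
  | case f g hf hg =>
    simp only [loopDefect, sem, not_or, forall_and] at hc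
    obtain ⟨h0, hw⟩ | ⟨n, u, rfl, hw⟩ := mem_case_eval_iff.1 h
    · exact Or.inl ⟨_, he.zeroTail v h0, hf hc.1 hw⟩
    · exact Or.inr ⟨_, he.decr n u, hg hc.2 hw⟩
  | fix f hf =>
    simp only [loopDefect, sem, not_or, forall_and, not_and, not_not] at hc
    obtain ⟨hc1, hc2, hc3⟩ := hc
    change L (loop f) (e v) (e w)
    refine fix_eval_induction (C := fun v => L (loop f) (e v) (e w)) ?_ ?_ h
    · rintro v u hu h0 rfl
      exact hc2 _ _ ⟨_, hf hc1 hu, he.zeroTail u h0⟩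
    · intro v u hu h0 ih
      rcases u with _ | ⟨_ | n, u⟩
      · simp at h0
      · simp at h0
      · exact hc3 _ _ ⟨_, hf hc1 hu, _, he.decr n u, _, he.tail (n :: u), ih⟩

/-- The graph of `c` after `n` increments of the head. -/
def incrGraph (c : Code) : ℕ → RelTerm ListLetter
  | 0 => c.graph
  | n + 1 => comp (gen incr) (incrGraph c n)

/-- The term that is nonempty if and only if the letters obey their laws, some element represents
`[]`, and `t` relates no representation of `[0]` to any result. -/
def noResult (c : Code) (t : RelTerm ListLetter) : RelTerm ListLetter :=
  -- A term between two copies of `top` denotes everything once it is nonempty, so subtracting it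
  -- forces its emptiness everywhere.
  diff (inter (gen nil) ident) (comp top (comp
    (union (union defect c.loopDefect) (comp (gen nil) (comp (gen push) t))) top))

theorem sem_incrGraph_interp {c : Code} {n m : ℕ} {v w : List ℕ} :
    (incrGraph c n).sem interp (m :: v) w ↔ w ∈ c.eval ((m + n) :: v) := by
  induction n generalizing m with
  | zero => exact c.sem_graph_interp _ _
  | succ n ih =>
    simp only [incrGraph, sem, interp]
    constructor
    · rintro ⟨_, ⟨_, _, h, rfl⟩, hw⟩
      obtain ⟨rfl, rfl⟩ := List.cons.inj h
      rw [ih] at hw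
      convert! hw using 3
      omega
    · intro hw
      refine ⟨_, ⟨_, _, rfl, rfl⟩, ih.2 ?_⟩
      convert! hw using 3
      omega

theorem Represents.sem_incrGraph {e : List ℕ → X} (he : Represents L e) {c : Code}
    (hc : ∀ a b, ¬ c.loopDefect.sem L a b) {n m : ℕ} {v w : List ℕ}
    (h : w ∈ c.eval ((m + n) :: v)) : (incrGraph c n).sem L (e (m :: v)) (e w) := by
  induction n generalizing m with
  | zero => exact he.sem_graph hc h
  | succ n ih =>
    refine ⟨_, he.incr m v, ih ?_⟩
    convert! h using 3
    omega

theorem sem_noResult_interp {c : Code} {n : ℕ} (h : ¬ (c.eval [n]).Dom) :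
    (noResult c (incrGraph c n)).sem interp [] [] := by
  refine ⟨⟨⟨rfl, rfl⟩, rfl⟩, ?_⟩
  rintro ⟨a, -, b, (h1 | h1) | ⟨_, ⟨rfl, rfl⟩, _, rfl, h1⟩, -⟩
  · exact not_sem_defect_interp _ _ h1
  · exact c.not_sem_loopDefect_interp _ _ h1
  · rw [sem_incrGraph_interp, Nat.zero_add] at h1
    exact h (Part.dom_iff_mem.2 ⟨_, h1⟩)

theorem not_dom_of_sem_noResult {c : Code} {n : ℕ} {a b : X}
    (h : (noResult c (incrGraph c n)).sem L a b) : ¬ (c.eval [n]).Dom := by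
  obtain ⟨⟨h₀, rfl⟩, h⟩ := h
  intro hd
  obtain ⟨w, hw⟩ := Part.dom_iff_mem.1 hd
  have hall : ∀ x y, ¬ (union (union defect c.loopDefect)
      (comp (gen nil) (comp (gen push) (incrGraph c n)))).sem L x y :=
    fun x y hxy => h ⟨x, trivial, y, hxy, trivial⟩
  simp only [sem, not_or, forall_and] at hall
  obtain ⟨⟨h1, h2⟩, h3⟩ := hall
  obtain ⟨e, he⟩ := exists_represents h1 h₀
  exact h3 _ _ ⟨_, he.nil, _, he.push [],
    he.sem_incrGraph h2 (by simpa using hw)⟩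

end ListLetter

/-! ### From many relation letters to one. -/

namespace ListLetter

open Turing.ToPartrec (Code)

/-- A numbering of the list letters. -/
def number : ListLetter → ℕ
  | nil => 0
  | push => 1
  | incr => 2
  | cons => 3
  | tail => 4
  | zeroTail => 5
  | decr => 6
  | sameHead => 7
  | loop c => c.number + 8

theorem number_injective : Function.Injective number := by
  intro a b h
  cases a <;> cases b <;> simp [number] at h ⊢
  exact Code.number_injective h

end ListLetter

namespace RelTerm

variable {Λ X : Type*}

/-- The loops of the single relation letter, which mark the elements of the encoded structure. -/
def loops : RelTerm Unit := inter ident (gen ())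

/-- The elements without a loop, which serve as inner points of paths. -/
def nonloops : RelTerm Unit := diff ident (gen ())

/-- Paths that start at an inner point, visit exactly `n + 1` inner points, and end at a loop. -/
def innerPath : ℕ → RelTerm Unit
  | 0 => comp nonloops (comp (gen ()) loops)
  | n + 1 => comp nonloops (comp (gen ()) (innerPath n))

/-- Paths from a loop to a loop with exactly `n + 1` inner points. -/
def labelledPath (n : ℕ) : RelTerm Unit := comp loops (comp (gen ()) (innerPath n))

/-- Encode a term over many letters into one over a single letter: the letters are replaced by
paths of different lengths, and the other operations are relativized to the elements with a
loop. -/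
def encodeLetters (idx : Λ → ℕ) : RelTerm Λ → RelTerm Unit
  | gen i => labelledPath (idx i)
  | ident => loops
  | top => comp loops (comp top loops)
  | union s t => union (s.encodeLetters idx) (t.encodeLetters idx)
  | inter s t => inter (s.encodeLetters idx) (t.encodeLetters idx)
  | diff s t => diff (s.encodeLetters idx) (t.encodeLetters idx)
  | comp s t => comp (s.encodeLetters idx) (t.encodeLetters idx)

@[simp]
theorem sem_loops {R : Unit → X → X → Prop} {a b : X} :
    loops.sem R a b ↔ a = b ∧ R () a a := by
  simp only [loops, sem]
  constructor <;> rintro ⟨rfl, h⟩ <;> exact ⟨rfl, h⟩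

@[simp]
theorem sem_nonloops {R : Unit → X → X → Prop} {a b : X} :
    nonloops.sem R a b ↔ a = b ∧ ¬ R () a a := by
  simp only [nonloops, sem]
  constructor <;> rintro ⟨rfl, h⟩ <;> exact ⟨rfl, h⟩

/-- Encoded terms relate only looped elements, so intersection, difference and composition behave as
in the structure `X` of looped elements. Leaving `ι` abstract serves both directions: decoding an
arbitrary relation and checking `PathGraph`. -/
theorem sem_encodeLetters {Y : Type*} {idx : Λ → ℕ} {R : Unit → Y → Y → Prop}
    {L : Λ → X → X → Prop} {ι : X → Y} (hι : Function.Injective ι)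
    (hloop : ∀ y, R () y y ↔ ∃ x, ι x = y)
    (hL : ∀ i a b, (labelledPath (idx i)).sem R (ι a) (ι b) ↔ L i a b) (t : RelTerm Λ) (y z : Y) :
    (t.encodeLetters idx).sem R y z ↔ ∃ a b, ι a = y ∧ ι b = z ∧ t.sem L a b := by
  have emb {s : RelTerm Λ} (hs : ∀ y z, (s.encodeLetters idx).sem R y z ↔
      ∃ a b, ι a = y ∧ ι b = z ∧ s.sem L a b) (a b : X) :
      (s.encodeLetters idx).sem R (ι a) (ι b) ↔ s.sem L a b := by
    rw [hs]
    constructor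
    · rintro ⟨a', b', ha, hb, h⟩
      rwa [← hι ha, ← hι hb]
    · exact fun h => ⟨a, b, rfl, rfl, h⟩
  induction t generalizing y z with
  | gen i =>
    constructor
    · intro h
      have hy : R () y y := by
        simp only [encodeLetters, labelledPath, sem, sem_loops] at h
        exact h.choose_spec.1.2
      have hz : ∀ (n : ℕ) (y : Y), (innerPath n).sem R y z → R () z z := by
        intro n
        induction n with
        | zero =>
          rintro y ⟨_, -, _, -, h⟩
          obtain ⟨rfl, h'⟩ := sem_loops.1 h
          exact h'
        | succ n ih =>
          rintro y ⟨_, -, _, -, h⟩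
          exact ih _ h
      obtain ⟨_, -, w, -, hw⟩ := id h
      obtain ⟨a, rfl⟩ := (hloop y).1 hy
      obtain ⟨b, rfl⟩ := (hloop z).1 (hz _ _ hw)
      exact ⟨a, b, rfl, rfl, (hL i a b).1 h⟩
    · rintro ⟨a, b, rfl, rfl, h⟩
      exact (hL i a b).2 h
  | ident =>
    simp only [encodeLetters, sem_loops, sem, hloop]
    constructor
    · rintro ⟨rfl, a, rfl⟩
      exact ⟨a, a, rfl, rfl, rfl⟩
    · rintro ⟨a, b, rfl, rfl, rfl⟩
      exact ⟨rfl, a, rfl⟩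
  | top =>
    simp only [encodeLetters, sem_loops, sem, hloop]
    constructor
    · rintro ⟨_, ⟨rfl, a, rfl⟩, _, -, rfl, b, rfl⟩
      exact ⟨a, b, rfl, rfl, trivial⟩
    · rintro ⟨a, b, rfl, rfl, -⟩
      exact ⟨_, ⟨rfl, a, rfl⟩, _, trivial, rfl, b, rfl⟩
  | union s t hs ht =>
    simp only [encodeLetters, sem, hs, ht]
    grind
  | inter s t hs ht | diff s t hs ht =>
    simp only [encodeLetters, sem]
    constructor
    · rintro ⟨h1, h2⟩
      obtain ⟨a, b, rfl, rfl, h1'⟩ := (hs _ _).1 h1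
      exact ⟨a, b, rfl, rfl, h1', by rwa [emb ht] at h2⟩
    · rintro ⟨a, b, rfl, rfl, h1, h2⟩
      rw [emb hs, emb ht]
      exact ⟨h1, h2⟩
  | comp s t hs ht =>
    simp only [encodeLetters, sem]
    constructor
    · rintro ⟨w, h1, h2⟩
      obtain ⟨a, b, rfl, rfl, h1'⟩ := (hs _ _).1 h1
      obtain ⟨b', c, hb, rfl, h2'⟩ := (ht _ _).1 h2
      obtain rfl := hι hb
      exact ⟨a, c, rfl, rfl, b', h1', h2'⟩
    · rintro ⟨a, c, rfl, rfl, b, h1, h2⟩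
      exact ⟨ι b, (emb hs _ _).2 h1, (emb ht _ _).2 h2⟩

/-- The graph that encodes the relations `L`: each pair `(a, b)` in the relation `L i` becomes a
path with inner points of its own, of which exactly `idx i + 1` precede `b`. -/
inductive PathGraph (idx : Λ → ℕ) (L : Λ → X → X → Prop) :
    X ⊕ (Λ × X × X × ℕ) → X ⊕ (Λ × X × X × ℕ) → Prop
  | loop (a) : PathGraph idx L (.inl a) (.inl a)
  | enter {i a b} (h : L i a b) : PathGraph idx L (.inl a) (.inr (i, a, b, 0))
  | step (i a b n) : PathGraph idx L (.inr (i, a, b, n)) (.inr (i, a, b, n + 1))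
  | leave (i a b) : PathGraph idx L (.inr (i, a, b, idx i)) (.inl b)

theorem sem_innerPath_pathGraph {idx : Λ → ℕ} {L : Λ → X → X → Prop} {i : Λ} {a b c : X}
    {m n : ℕ} :
    (innerPath n).sem (fun _ => PathGraph idx L) (.inr (i, a, b, m)) (.inl c) ↔
      b = c ∧ m + n = idx i := by
  have hl : ∀ p, ¬ PathGraph idx L (.inr p) (.inr p) := by
    rintro ⟨i, a, b, n⟩ h
    cases h
  induction n generalizing m with
  | zero =>
    simp only [innerPath, sem, sem_nonloops, sem_loops]
    constructor
    · rintro ⟨_, ⟨rfl, -⟩, _, h, rfl, -⟩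
      cases h
      exact ⟨rfl, rfl⟩
    · rintro ⟨rfl, rfl⟩
      exact ⟨_, ⟨rfl, hl _⟩, _, .leave _ _ _, rfl, .loop _⟩
  | succ n ih =>
    simp only [innerPath, sem, sem_nonloops]
    constructor
    · rintro ⟨_, ⟨rfl, -⟩, _, h, h'⟩
      cases h with
      | step =>
        obtain ⟨hb, hn⟩ := ih.1 h'
        exact ⟨hb, by omega⟩
      -- Leaving early reaches a looped element, whereas the rest of the path must begin at an inner
      -- point.
      | leave =>
        exfalso
        cases n <;> obtain ⟨_, h, -⟩ := h' <;> exact (sem_nonloops.1 h).2 (.loop _)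
    · rintro ⟨rfl, h⟩
      exact ⟨_, ⟨rfl, hl _⟩, _, .step _ _ _ _, ih.2 ⟨rfl, by omega⟩⟩

theorem sem_labelledPath_pathGraph {idx : Λ → ℕ} (hidx : Function.Injective idx)
    {L : Λ → X → X → Prop} {i : Λ} {a b : X} :
    (labelledPath (idx i)).sem (fun _ => PathGraph idx L) (.inl a) (.inl b) ↔ L i a b := by
  simp only [labelledPath, sem, sem_loops]
  constructor
  · rintro ⟨_, ⟨rfl, -⟩, _, h, h'⟩
    cases h with
    | loop =>
      exfalso
      generalize idx i = n at h'
      cases n <;> obtain ⟨_, h, -⟩ := h' <;> exact (sem_nonloops.1 h).2 (.loop _)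
    | enter h =>
      obtain ⟨rfl, h2⟩ := sem_innerPath_pathGraph.1 h'
      rw [Nat.zero_add] at h2
      rwa [hidx h2]
  · intro h
    exact ⟨_, ⟨rfl, .loop a⟩, _, .enter h, sem_innerPath_pathGraph.2 ⟨rfl, Nat.zero_add _⟩⟩

theorem sem_comap_equiv {Y : Type*} (e : Y ≃ X) (R : Λ → X → X → Prop) (t : RelTerm Λ) (a b : Y) :
    t.sem (fun i a b => R i (e a) (e b)) a b ↔ t.sem R (e a) (e b) := by
  induction t generalizing a b with
  | gen i => rfl
  | ident => simp
  | top => rfl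
  | union s t hs ht | inter s t hs ht | diff s t hs ht => simp only [sem, hs, ht]
  | comp s t hs ht => simp only [sem, hs, ht, e.exists_congr_left, Equiv.apply_symm_apply]

/-- Some relation on `dom` makes the term nonempty. -/
def Satisfiable (dom : Type*) (t : RelTerm Unit) : Prop :=
  ∃ (R : Unit → dom → dom → Prop) (a b : dom), t.sem R a b

theorem satisfiable_encodeLetters {dom : Type*} [Countable dom] [Infinite dom] [Countable X]
    [Nonempty X] [Nonempty Λ] {idx : Λ → ℕ} (hidx : Function.Injective idx) {t : RelTerm Λ}
    {L : Λ → X → X → Prop} {a b : X} (h : t.sem L a b) :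
    Satisfiable dom (t.encodeLetters idx) := by
  have : Countable Λ := hidx.countable
  -- The unbounded supply of inner points makes the graph infinite even when `X` is finite.
  obtain ⟨e⟩ : Nonempty (dom ≃ X ⊕ (Λ × X × X × ℕ)) := inferInstance
  refine ⟨fun _ x y => PathGraph idx L (e x) (e y), e.symm (.inl a), e.symm (.inl b), ?_⟩
  rw [sem_comap_equiv e (fun _ => PathGraph idx L), e.apply_symm_apply, e.apply_symm_apply,
    sem_encodeLetters (ι := Sum.inl) (L := L) Sum.inl_injective]
  · exact ⟨a, b, rfl, rfl, h⟩
  · rintro (x | ⟨i, a, b, n⟩)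
    · exact ⟨fun _ => ⟨x, rfl⟩, fun _ => .loop x⟩
    · simp only [reduceCtorEq, exists_false, iff_false]
      intro h
      cases h
  · exact fun i a b => sem_labelledPath_pathGraph hidx

/-- No shape is required of the relation: its looped points form the universe, and the labelled
paths define the letters. -/
theorem Satisfiable.exists_sem {dom : Type*} {idx : Λ → ℕ} {t : RelTerm Λ}
    (h : Satisfiable dom (t.encodeLetters idx)) :
    ∃ (X : Set dom) (L : Λ → X → X → Prop) (a b : X), t.sem L a b := by
  obtain ⟨R, y, z, h⟩ := h
  rw [sem_encodeLetters (X := {x | R () x x}) (ι := Subtype.val)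
    (L := fun i a b => (labelledPath (idx i)).sem R a b) Subtype.val_injective] at h
  · obtain ⟨a, b, -, -, h⟩ := h
    exact ⟨_, _, a, b, h⟩
  · simp
  · exact fun _ _ _ => Iff.rfl

end RelTerm

open Turing.ToPartrec in
theorem ListLetter.satisfiable_noResult_iff {dom : Type*} [Countable dom] [Infinite dom]
    {c : Code} {n : ℕ} :
    RelTerm.Satisfiable dom ((noResult c (incrGraph c n)).encodeLetters number) ↔
      ¬ (c.eval [n]).Dom := by
  constructor
  · intro h
    obtain ⟨X, L, a, b, h⟩ := h.exists_sem
    exact not_dom_of_sem_noResult h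
  · intro h
    have : Nonempty ListLetter := ⟨nil⟩
    exact RelTerm.satisfiable_encodeLetters number_injective (sem_noResult_interp h)

/-! ### Computability of the words. -/

namespace LIF

variable {S : Vocabulary} {V dom : Type*}

section Frame

variable [Encodable S.Names] [Encodable V]

/-- An operation on expressions that puts fixed words before and after the word of its
argument. -/
def IsFrame (C : LIF S V → LIF S V) : Prop :=
  ∃ pre post, ∀ α, (C α).code = pre ++ α.code ++ post

variable {C : LIF S V → LIF S V}

theorem isFrame_id : IsFrame fun α : LIF S V => α := ⟨[], [], by simp⟩

theorem IsFrame.union_right (h : IsFrame C) (β : LIF S V) : IsFrame fun α => union β (C α) := by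
  obtain ⟨u, v, h⟩ := h
  exact ⟨2 :: (β.code ++ u), v, by simp [code, h]⟩

theorem IsFrame.inter_left (h : IsFrame C) (β : LIF S V) : IsFrame fun α => inter (C α) β := by
  obtain ⟨u, v, h⟩ := h
  exact ⟨3 :: u, v ++ β.code, by simp [code, h]⟩

theorem IsFrame.inter_right (h : IsFrame C) (β : LIF S V) : IsFrame fun α => inter β (C α) := by
  obtain ⟨u, v, h⟩ := h
  exact ⟨3 :: (β.code ++ u), v, by simp [code, h]⟩

theorem IsFrame.diff_right (h : IsFrame C) (β : LIF S V) : IsFrame fun α => diff β (C α) := by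
  obtain ⟨u, v, h⟩ := h
  exact ⟨4 :: (β.code ++ u), v, by simp [code, h]⟩

theorem IsFrame.comp_left (h : IsFrame C) (β : LIF S V) : IsFrame fun α => comp (C α) β := by
  obtain ⟨u, v, h⟩ := h
  exact ⟨5 :: u, v ++ β.code, by simp [code, h]⟩

theorem IsFrame.comp_right (h : IsFrame C) (β : LIF S V) : IsFrame fun α => comp β (C α) := by
  obtain ⟨u, v, h⟩ := h
  exact ⟨5 :: (β.code ++ u), v, by simp [code, h]⟩

theorem IsFrame.cylL (h : IsFrame C) (Z : Finset V) : IsFrame fun α => cylL Z (C α) := by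
  obtain ⟨u, v, h⟩ := h
  exact ⟨6 :: (codeFinset Z ++ u), v, by simp [code, h]⟩

theorem IsFrame.cylR (h : IsFrame C) (Z : Finset V) : IsFrame fun α => cylR Z (C α) := by
  obtain ⟨u, v, h⟩ := h
  exact ⟨7 :: (codeFinset Z ++ u), v, by simp [code, h]⟩

theorem IsFrame.selR (h : IsFrame C) (x y : V) : IsFrame fun α => selR x y (C α) := by
  obtain ⟨u, v, h⟩ := h
  exact ⟨10 :: Encodable.encode x :: Encodable.encode y :: u, v, by simp [code, h]⟩

theorem IsFrame.computable (hC : IsFrame C) {f : ℕ → LIF S V}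
    (hf : Computable fun n => (f n).code) : Computable fun n => (C (f n)).code := by
  obtain ⟨u, v, h⟩ := hC
  simp only [h]
  exact Computable.list_append.comp (Computable.list_append.comp (Computable.const u) hf)
    (Computable.const v)

theorem IsFrame.computable_iterate (hC : IsFrame C) {f : ℕ → LIF S V}
    (hf : ∀ n, f (n + 1) = C (f n)) : Computable fun n => (f n).code := by
  obtain ⟨u, v, h⟩ := hC
  have step : Computable₂ fun (_ : ℕ) (p : ℕ × List ℕ) => u ++ p.2 ++ v :=
    Computable.list_append.comp (Computable.list_append.comp (Computable.const u)
      (Computable.snd.comp Computable.snd)) (Computable.const v)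
  refine (Computable.nat_rec Computable.id (Computable.const (f 0).code) step).of_eq fun n => ?_
  induction n with
  | zero => rfl
  | succ n ih => rw [hf, h, ← ih]; rfl

/-- A translation of relation terms into expressions that treats certain operations as frames. -/
structure HasFrames (tr : RelTerm Unit → LIF S V) : Prop where
  comp_left (s) : ∃ C, IsFrame C ∧ ∀ t, tr (.comp t s) = C (tr t)
  comp_right (s) : ∃ C, IsFrame C ∧ ∀ t, tr (.comp s t) = C (tr t)
  union_right (s) : ∃ C, IsFrame C ∧ ∀ t, tr (.union s t) = C (tr t)
  diff_right (s) : ∃ C, IsFrame C ∧ ∀ t, tr (.diff s t) = C (tr t)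

open ListLetter in
theorem HasFrames.computable_noResult {tr : RelTerm Unit → LIF S V} (h : HasFrames tr)
    (c : Turing.ToPartrec.Code) :
    Computable fun n => (tr ((noResult c (incrGraph c n)).encodeLetters number)).code := by
  have lift {F : RelTerm Unit → RelTerm Unit} (hF : ∃ C, IsFrame C ∧ ∀ t, tr (F t) = C (tr t))
      {f : ℕ → RelTerm Unit} (hf : Computable fun n => (tr (f n)).code) :
      Computable fun n => (tr (F (f n))).code := by
    obtain ⟨C, hC, h⟩ := hF
    simp only [h]
    exact hC.computable hf
  obtain ⟨C, hC, hstep⟩ := h.comp_right (RelTerm.labelledPath (number incr))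
  -- Each further increment wraps the same frame around the previous word.
  have base : Computable fun n => (tr ((incrGraph c n).encodeLetters number)).code :=
    hC.computable_iterate fun n => hstep _
  exact lift (h.diff_right _) <| lift (h.comp_right _) <| lift (h.comp_left _) <|
    lift (h.union_right _) <| lift (h.comp_right _) <| lift (h.comp_right _) base

end Frame

/-! ### Relation terms as LIF expressions. -/

/-- Translation of relation terms over one letter into expressions, for a single variable `x`: an
element is represented by the value of `x`. -/
def ofRelTerm (M : S.Names) (x : V) : RelTerm Unit → LIF S V
  | .gen _ => atom M fun _ => x
  | .ident => id
  | .top => cylL {x} id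
  | .union s t => union (ofRelTerm M x s) (ofRelTerm M x t)
  | .inter s t => inter (ofRelTerm M x s) (ofRelTerm M x t)
  | .diff s t => diff (ofRelTerm M x s) (ofRelTerm M x t)
  | .comp s t => comp (ofRelTerm M x s) (ofRelTerm M x t)

/-- The pairs of valuations whose left value of `x` is related to the right value of `x` by the
relation that `α` tests on `x` and `y`. -/
def liftLeft (x y : V) (α : LIF S V) : LIF S V :=
  cylR {y} (cylL {y} (selR x y (cylR {x} α)))

/-- The pairs of valuations whose right value of `x` is related to the left value of `y` by the
relation that `α` tests on `x` and `y`. -/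
def liftRight (x y : V) (α : LIF S V) : LIF S V := cylL {x} (cylR {y} α)

open Classical in
/-- Translation of relation terms over one letter into expressions that test whether the values
of `x` and `y` are related. -/
noncomputable def testOfRelTerm (M : S.Names) (x y : V) : RelTerm Unit → LIF S V
  | .gen _ => inter id (atom M fun i => if (i : ℕ) < 1 then x else y)
  | .ident => selL x y id
  | .top => id
  | .union s t => union (testOfRelTerm M x y s) (testOfRelTerm M x y t)
  | .inter s t => inter (testOfRelTerm M x y s) (testOfRelTerm M x y t)
  | .diff s t => diff (testOfRelTerm M x y s) (testOfRelTerm M x y t)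
  | .comp s t => inter id (cylR {x, y}
      (inter (liftLeft x y (testOfRelTerm M x y s)) (liftRight x y (testOfRelTerm M x y t))))

theorem hasFrames_ofRelTerm [Encodable S.Names] [Encodable V] (M : S.Names) (x : V) :
    HasFrames (ofRelTerm M x) where
  comp_left s := ⟨_, isFrame_id.comp_left (ofRelTerm M x s), fun _ => rfl⟩
  comp_right s := ⟨_, isFrame_id.comp_right (ofRelTerm M x s), fun _ => rfl⟩
  union_right s := ⟨_, isFrame_id.union_right (ofRelTerm M x s), fun _ => rfl⟩
  diff_right s := ⟨_, isFrame_id.diff_right (ofRelTerm M x s), fun _ => rfl⟩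

theorem hasFrames_testOfRelTerm [Encodable S.Names] [Encodable V] (M : S.Names) (x y : V) :
    HasFrames (testOfRelTerm M x y) where
  comp_left s := ⟨_, (((((((isFrame_id.cylR {x}).selR x y).cylL {y}).cylR {y}).inter_left
    (liftRight x y (testOfRelTerm M x y s))).cylR _).inter_right id), fun _ => rfl⟩
  comp_right s := ⟨_, (((((isFrame_id.cylR {y}).cylL {x}).inter_right
    (liftLeft x y (testOfRelTerm M x y s))).cylR _).inter_right id), fun _ => rfl⟩
  union_right s := ⟨_, isFrame_id.union_right (testOfRelTerm M x y s), fun _ => rfl⟩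
  diff_right s := ⟨_, isFrame_id.diff_right (testOfRelTerm M x y s), fun _ => rfl⟩

/-- The binary relation that an interpretation induces on data elements when the first `k`
positions of `M` are identified, as are the others. -/
def binaryRel (D : Interpretation S dom) (M : S.Names) (k : ℕ) (a b : dom) : Prop :=
  (fun i : Fin (S.ar M) => if (i : ℕ) < k then a else b) ∈ D M

theorem exists_binaryRel_eq {M : S.Names} {k : ℕ} (h0 : 0 < k) (hk : k < S.ar M)
    (R : dom → dom → Prop) : ∃ D : Interpretation S dom, binaryRel D M k = R := by
  refine ⟨fun M => {u | ∃ a b, R a b ∧ u = fun i : Fin (S.ar M) => if (i : ℕ) < k then a else b},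
    ?_⟩
  ext a b
  constructor
  · rintro ⟨a', b', h, e⟩
    have ha := congrFun e ⟨0, by omega⟩
    have hb := congrFun e ⟨k, hk⟩
    simp only [h0, if_true, lt_irrefl, if_false] at ha hb
    rwa [ha, hb]
  · exact fun h => ⟨a, b, h, rfl⟩

/-- A valuation is its value at `x`. The atom has an output position, so inertia imposes nothing on
`x`. -/
theorem mem_sem_ofRelTerm [Subsingleton V] {M : S.Names} (hM : S.iar M < S.ar M) (x : V)
    (D : Interpretation S dom) (t : RelTerm Unit) (p : VarValuation V dom × VarValuation V dom) :
    p ∈ (ofRelTerm M x t).sem D ↔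
      t.sem (fun _ => binaryRel D M (S.iar M)) (p.1 x) (p.2 x) := by
  have ext_iff {ν μ : V → dom} : ν = μ ↔ ν x = μ x :=
    ⟨fun h => h ▸ rfl, fun h => funext fun v => by rwa [Subsingleton.elim v x]⟩
  induction t generalizing p with
  | gen _ =>
    refine ⟨fun h => h.1, fun h => ⟨h, fun v hv => ?_⟩⟩
    exact absurd (Subsingleton.elim x v) (hv ⟨S.iar M, hM⟩ le_rfl)
  | ident => exact ext_iff
  | top =>
    refine iff_of_true ⟨p.2, rfl, fun v hv => ?_⟩ trivial
    exact absurd (Finset.mem_singleton.2 (Subsingleton.elim v x)) hv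
  | union s t hs ht => exact or_congr (hs p) (ht p)
  | inter s t hs ht => exact and_congr (hs p) (ht p)
  | diff s t hs ht => exact and_congr (hs p) (not_congr (ht p))
  | comp s t hs ht =>
    constructor
    · rintro ⟨ν, h1, h2⟩
      exact ⟨ν x, (hs _).1 h1, (ht _).1 h2⟩
    · rintro ⟨c, h1, h2⟩
      exact ⟨fun _ => c, (hs _).2 h1, (ht _).2 h2⟩

section Tests

variable {x y : V} {D : Interpretation S dom} {α : LIF S V} {T : dom → dom → Prop}

theorem mem_sem_liftLeft (hxy : x ≠ y)
    (hα : ∀ p, p ∈ α.sem D ↔ p.1 = p.2 ∧ T (p.1 x) (p.1 y))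
    (p : VarValuation V dom × VarValuation V dom) :
    p ∈ (liftLeft x y α).sem D ↔
      T (p.1 x) (p.2 x) ∧ ∀ v, v ≠ x → v ≠ y → p.1 v = p.2 v := by
  classical
  simp only [liftLeft, sem, BRV.cylR, BRV.cylL, BRV.selR, Set.mem_ofPred_eq, hα,
    Finset.mem_singleton]
  constructor
  · rintro ⟨ν, ⟨μ, ⟨⟨κ, ⟨rfl, hT⟩, h1⟩, h2⟩, h3⟩, h4⟩
    have e1 := h3 x hxy
    have e2 := h4 x hxy
    have e3 := h1 y hxy.symm
    refine ⟨?_, fun v hx hy => ?_⟩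
    · rwa [← e1, ← e2, h2, ← e3]
    · rw [← h3 v hy, h1 v hx, h4 v hy]
  · rintro ⟨hT, h⟩
    -- The right selection forces `y` to carry `p.2 x` on the right, and the test fixes the same
    -- value for `y` on the left.
    refine ⟨Function.update p.2 y (p.2 x), ⟨Function.update p.1 y (p.2 x),
      ⟨⟨_, ⟨rfl, ?_⟩, ?_⟩, ?_⟩, ?_⟩, ?_⟩
    · simpa [hxy] using hT
    · intro v hv
      by_cases hy : v = y
      · simp [hy]
      · simpa [hy] using h v hv hy
    · simp [hxy]
    · intro v hv
      simp [hv]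
    · intro v hv
      simp [hv]

theorem mem_sem_liftRight (hxy : x ≠ y)
    (hα : ∀ p, p ∈ α.sem D ↔ p.1 = p.2 ∧ T (p.1 x) (p.1 y))
    (p : VarValuation V dom × VarValuation V dom) :
    p ∈ (liftRight x y α).sem D ↔
      T (p.2 x) (p.1 y) ∧ ∀ v, v ≠ x → v ≠ y → p.1 v = p.2 v := by
  classical
  simp only [liftRight, sem, BRV.cylR, BRV.cylL, Set.mem_ofPred_eq, hα, Finset.mem_singleton]
  constructor
  · rintro ⟨ν, ⟨μ, ⟨rfl, hT⟩, h1⟩, h2⟩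
    have e1 := h1 x hxy
    have e2 := h2 y hxy.symm
    refine ⟨?_, fun v hx hy => ?_⟩
    · rwa [← e1, ← e2]
    · rw [← h2 v hx, h1 v hy]
  · rintro ⟨hT, h⟩
    refine ⟨Function.update p.1 x (p.2 x), ⟨_, ⟨rfl, ?_⟩, ?_⟩, ?_⟩
    · simpa [hxy.symm] using hT
    · intro v hv
      by_cases hx : v = x
      · simp [hx]
      · simpa [hx] using h v hx hv
    · intro v hv
      simp [hv]

/-- Tests lie on the diagonal, so inputs and outputs are read in the same valuation. Splitting
positions at 1 therefore works for any input arity. -/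
theorem mem_sem_testOfRelTerm (hxy : x ≠ y) (M : S.Names) (D : Interpretation S dom)
    (t : RelTerm Unit) (p : VarValuation V dom × VarValuation V dom) :
    p ∈ (testOfRelTerm M x y t).sem D ↔
      p.1 = p.2 ∧ t.sem (fun _ => binaryRel D M 1) (p.1 x) (p.1 y) := by
  classical
  induction t generalizing p with
  | gen _ =>
    refine and_congr_right fun (h : p.1 = p.2) => ?_
    change (_ ∧ _) ↔ binaryRel D M 1 (p.1 x) (p.1 y)
    have key : (fun i : Fin (S.ar M) => if (i : ℕ) < S.iar M then
        p.1 (if (i : ℕ) < 1 then x else y) else p.2 (if (i : ℕ) < 1 then x else y)) =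
        fun i : Fin (S.ar M) => if (i : ℕ) < 1 then p.1 x else p.1 y := by
      funext i
      rw [← h, ite_self, apply_ite p.1]
    rw [key, binaryRel]
    exact and_iff_left fun v _ => congrFun h v
  | ident => exact Iff.rfl
  | top => exact (and_iff_left trivial).symm
  | union s t hs ht => exact (or_congr (hs p) (ht p)).trans and_or_left.symm
  | inter s t hs ht => exact (and_congr (hs p) (ht p)).trans and_and_left.symm
  | diff s t hs ht =>
    refine (and_congr (hs p) (not_congr (ht p))).trans ?_
    simp only [RelTerm.sem]
    tauto
  | comp s t hs ht =>
    refine and_congr_right fun (h : p.1 = p.2) => ?_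
    simp only [sem, BRV.cylR, Set.mem_ofPred_eq, Set.mem_inter_iff, mem_sem_liftLeft hxy hs,
      mem_sem_liftRight hxy ht, RelTerm.sem, Finset.mem_insert, Finset.mem_singleton, not_or]
    constructor
    · rintro ⟨ν, ⟨⟨h1, -⟩, h2, -⟩, -⟩
      exact ⟨_, h1, h2⟩
    -- The intermediate point `c` is stored as the right value of `x`; the left valuation keeps both
    -- endpoints.
    · rintro ⟨c, h1, h2⟩
      have off (v) (hx : v ≠ x) : p.1 v = Function.update p.1 x c v := by simp [hx]
      refine ⟨Function.update p.1 x c, ⟨⟨by simpa using h1, fun v hx _ => off v hx⟩,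
        by simpa using h2, fun v hx _ => off v hx⟩, fun v hv => ?_⟩
      rw [← off v hv.1, h]

end Tests

/-! ### From satisfiability to semantic outputs, and undecidability. -/

theorem mem_semanticOutputs_ofRelTerm [Subsingleton V] [Nontrivial dom] {M : S.Names}
    (h0 : 0 < S.iar M) (hM : S.iar M < S.ar M) (x : V) (t : RelTerm Unit) :
    x ∈ (cylL {x} (cylR {x} (ofRelTerm M x t))).semanticOutputs dom ↔ t.Satisfiable dom := by
  constructor
  · rintro ⟨D, p, ⟨ν, ⟨μ, h, -⟩, -⟩, -⟩
    exact ⟨_, _, _, (mem_sem_ofRelTerm hM x D t _).1 h⟩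
  · rintro ⟨R, a, b, h⟩
    obtain ⟨D, hD⟩ := exists_binaryRel_eq h0 hM (R ())
    obtain ⟨a', b', hab⟩ := exists_pair_ne dom
    have mem (v : V) : v ∈ ({x} : Finset V) := Finset.mem_singleton.2 (Subsingleton.elim v x)
    refine ⟨D, (fun _ => a', fun _ => b'), ⟨fun _ => a, ⟨fun _ => b, ?_,
      fun v hv => absurd (mem v) hv⟩, fun v hv => absurd (mem v) hv⟩, hab⟩
    rw [mem_sem_ofRelTerm hM, hD]
    exact h

open Classical in
theorem mem_semanticOutputs_testOfRelTerm [Nontrivial dom] {x y : V} (hxy : x ≠ y)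
    {M : S.Names} (hM : 2 ≤ S.ar M) (t : RelTerm Unit) :
    x ∈ (cylL {x, y} (cylR {x, y} (testOfRelTerm M x y t))).semanticOutputs dom ↔
      t.Satisfiable dom := by
  constructor
  · rintro ⟨D, p, ⟨ν, ⟨μ, h, -⟩, -⟩, -⟩
    exact ⟨_, _, _, ((mem_sem_testOfRelTerm hxy M D t _).1 h).2⟩
  · rintro ⟨R, a, b, h⟩
    obtain ⟨D, hD⟩ := exists_binaryRel_eq one_pos hM (R ())
    -- The tested pair is diagonal; cylindrification permits changing its right value of `x` to some
    -- `a' ≠ a`.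
    obtain ⟨a', hab⟩ := exists_ne a
    let ν : V → dom := fun v => if v = x then a else b
    refine ⟨D, (ν, Function.update ν x a'), ⟨ν, ⟨ν, ?_, fun v hv => ?_⟩, fun _ _ => rfl⟩, ?_⟩
    · rw [mem_sem_testOfRelTerm hxy, hD]
      exact ⟨rfl, by simpa [ν, hxy.symm] using h⟩
    · have hx : v ≠ x := fun e => hv (by simp [e])
      simp [hx]
    · simpa [ν] using hab.symm

end LIF

open Turing.ToPartrec in
/-- Some code has an undecidable halting problem on one-element lists. -/
theorem exists_code_not_computablePred_dom :
    ∃ c : Code, ¬ ComputablePred fun n : ℕ => (c.eval [n]).Dom := by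
  -- A universal function: the input is the number of a program, which is run on 0.
  let f : ℕ →. ℕ := fun n => (Denumerable.ofNat Nat.Partrec.Code n).eval 0
  have hf : Partrec f :=
    Nat.Partrec.Code.eval_part.comp (Computable.ofNat _) (Computable.const 0)
  obtain ⟨c, hc⟩ := Code.exists_code (Nat.Partrec'.part_iff₁.2 hf)
  refine ⟨c, fun h => ComputablePred.halting_problem 0 ?_⟩
  have hdom (n : ℕ) : (c.eval [n]).Dom ↔ (f n).Dom := by
    have := hc ⟨[n], rfl⟩
    change c.eval [n] = _ at this
    rw [this]
    rfl
  refine ComputablePred.computable_of_manyOneReducible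
    ⟨Encodable.encode, Computable.encode, fun d => ?_⟩ h
  rw [hdom]
  simp [f]

open ListLetter in
theorem not_semanticOutputMembershipDecidable_of_hasFrames {S : Vocabulary} [Encodable S.Names]
    {V : Type*} [Encodable V] {dom : Type*} [Countable dom] [Infinite dom]
    {tr : RelTerm Unit → LIF S V} (htr : LIF.HasFrames tr) (x : V) (Z Z' : Finset V)
    (h : ∀ t, x ∈ (LIF.cylL Z (LIF.cylR Z' (tr t))).semanticOutputs dom ↔ t.Satisfiable dom) :
    ¬ SemanticOutputMembershipDecidable S V dom := by
  rintro ⟨P, hP, hPx⟩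
  obtain ⟨c, hc⟩ := exists_code_not_computablePred_dom
  have hcode := ((LIF.isFrame_id.cylR Z').cylL Z).computable (htr.computable_noResult c)
  have hred : ComputablePred fun n : ℕ => ¬ (c.eval [n]).Dom :=
    ComputablePred.computable_of_manyOneReducible
      ⟨_, (Computable.const (Encodable.encode x)).pair hcode, fun n => by
        rw [hPx, h, satisfiable_noResult_iff]⟩ hP
  exact hc (hred.not.of_eq fun n => not_not)

theorem mainTheorem9 (S : Vocabulary) [Encodable S.Names]
    (V : Type*) [Encodable V] [Nonempty V]
    (dom : Type*) [Countable dom] [Infinite dom]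
    (hS : ∃ M : S.Names, 2 ≤ S.ar M ∧
      (Nontrivial V ∨ (0 < S.iar M ∧ S.iar M < S.ar M))) :
    ¬ SemanticOutputMembershipDecidable S V dom := by
  obtain ⟨M, hM, hV⟩ := hS
  rcases subsingleton_or_nontrivial V with hsub | hnt
  · obtain ⟨h0, h1⟩ := hV.resolve_left (not_nontrivial_iff_subsingleton.2 hsub)
    obtain ⟨x⟩ := ‹Nonempty V›
    exact not_semanticOutputMembershipDecidable_of_hasFrames (LIF.hasFrames_ofRelTerm M x) x _ _
      (LIF.mem_semanticOutputs_ofRelTerm h0 h1 x)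
  · obtain ⟨x, y, hxy⟩ := exists_pair_ne V
    exact not_semanticOutputMembershipDecidable_of_hasFrames
      (LIF.hasFrames_testOfRelTerm M x y) x _ _
      (LIF.mem_semanticOutputs_testOfRelTerm hxy hM)
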